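/- Let $F=\mathrm{GF}(q)$, let $\mathcal C$ be an $[n,k]$ linear code over $F$ with $k\ge 1$, and let $G\in F^{k\times n}$ be a generator matrix of $\mathcal C$. An information set is a set $\mathcal I\subseteq\{1,\dots,n\}$ of size $k$ such that the submatrix of $G$ formed by the columns in $\mathcal I$ is invertible. A binary $\nu\times n$ matrix $\Lambda_{\kappa,\nu}$ is a PIR achievable rate matrix for $\mathcal C$ if every column has Hamming weight $\kappa$ and the support $\chi(\lambda_i)$ of every row $\lambda_i$ contains an information set. A distributed storage system stores $f$ files $X^{(1)},\dots,X^{(f)}\in F^{\beta\times k}$ on $n$ nodes; node $l$ stores the $l$-th columns of the matrices $X^{(1)}G,\dots,X^{(f)}G$. In a PIR scheme, a user who wants file $m$ sends a random query $Q_l^{(m)}$, drawn independently of the files, to each node $l$. Node $l$ returns a response $A_l^{(m)}\in F^{d_l}$ that is a deterministic function of $Q_l^{(m)}$ and of the symbols it stores. The scheme is perfect if $I(m;Q_l^{(m)},A_l^{(m)},X^{(1)},\dots,X^{(f)})=0$ for every node $l$ (privacy) and $H(X^{(m)}\mid A_1^{(m)},\dots,A_n^{(m)},Q_1^{(m)},\dots,Q_n^{(m)})=0$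 for every $m$ (recovery), for all distributions of the requested index and of the files with these two independent of each other. Its PIR rate is $\beta k/\sum_{l=1}^n d_l$. Suppose that $\mathcal C$ has a PIR achievable rate matrix $\Lambda_{\kappa,\nu}$ with $\kappa<\nu$. Then there are information sets $\mathcal I_i\subseteq\chi(\lambda_i)$, $i=1,\dots,\nu$, such that the following hold. (a) For every number of files $f\ge 1$ there are a number of stripes $\beta\ge 1$ and a perfect PIR scheme of PIR rate exactly $$R_{f,\mathsf A}(\mathcal C)=\Bigl(1-\frac{\kappa}{\nu}\Bigr)\Bigl[1-\Bigl(\frac{\kappa}{\nu}\Bigr)^{f}\Bigr]^{-1}.$$ (b) There are $\beta\ge1$ and $d_1,\dots,d_n$, not depending on $f$, with $\beta k/\sum_l d_l=1-\frac{\kappa}{\nu}$, such that for every $f\ge 1$ there is a perfect PIR scheme for $f$ files of $\beta$ stripes that downloads $d_l$ symbols from node $l$. Moreover $\lim_{f\to\infty}R_{f,\mathsf A}(\mathcal C)=1-\frac{\kappa}{\nu}$. In (a) and in (b) the scheme can be chosen so that the redundant coordinates in $\chi(\lambda_i)\setminus\mathcal I_i$ are dropped, in the sense that for some constant $c$ (which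 in (a) may depend on $f$) exactly $d_l=c\cdot|\{i: l\in\mathcal I_i\}|$ symbols are downloaded from each node $l$. -/

import Mathlib

open scoped Topology

namespace PIR

noncomputable section

/-! ### Entropy of random variables with finitely many values -/

/-- Shannon entropy (in nats) of a probability distribution on a finite set. -/
def entropy {α : Type*} [Fintype α] (p : PMF α) : ℝ :=
  ∑ a, Real.negMulLog (p a).toReal

/-- Mutual information `I(U;V) = H(U) + H(V) - H(U,V)`, where `p` is the joint law of `(U,V)`. -/
def mutualInfo {α γ : Type*} [Fintype α] [Fintype γ] (p : PMF (α × γ)) : ℝ :=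
  entropy (p.map Prod.fst) + entropy (p.map Prod.snd) - entropy p

/-- Conditional entropy `H(U|V) = H(U,V) - H(V)`, where `p` is the joint law of `(U,V)`. -/
def condEntropy {α γ : Type*} [Fintype α] [Fintype γ] (p : PMF (α × γ)) : ℝ :=
  entropy p - entropy (p.map Prod.snd)

/-! ### Linear codes and PIR achievable rate matrices -/

/-- `C` is an `[n,k]` code over `F`, and `G` is a generator matrix of `C`: the `k` rows of `G`
span the `k`-dimensional space `C`. -/
def IsGeneratorMatrix {F : Type*} [Field F] {n k : ℕ}
    (C : Submodule F (Fin n → F)) (G : Matrix (Fin k) (Fin n) F) : Prop :=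
  Module.finrank F C = k ∧ Submodule.span F (Set.range fun i => G i) = C

/-- `I` is an information set: it has `k` elements and the `k × k` matrix formed by the columns
of `G` indexed by `I` is invertible. -/
def IsInformationSet {F : Type*} [Field F] {n k : ℕ}
    (G : Matrix (Fin k) (Fin n) F) (I : Finset (Fin n)) : Prop :=
  ∃ e : Fin k ≃ I, IsUnit (G.submatrix id fun j => (e j : Fin n))

/-- The support of the `i`-th row of a binary matrix. -/
def rowSupport {n ν : ℕ} (Λ : Matrix (Fin ν) (Fin n) (ZMod 2)) (i : Fin ν) : Finset (Fin n) :=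
  Finset.univ.filter fun j => Λ i j ≠ 0

/-- The `ν × n` binary matrix `Λ` is a PIR achievable rate matrix `Λ_{κ,ν}`: every column has
Hamming weight `κ`, and the support of every row contains an information set. -/
def IsPIRAchievableRateMatrix {F : Type*} [Field F] {n k : ℕ} (G : Matrix (Fin k) (Fin n) F)
    (κ ν : ℕ) (Λ : Matrix (Fin ν) (Fin n) (ZMod 2)) : Prop :=
  (∀ j, hammingNorm (fun i => Λ i j) = κ) ∧
    ∀ i, ∃ I : Finset (Fin n), IsInformationSet G I ∧ I ⊆ rowSupport Λ i

/-! ### PIR schemes -/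

/-- The collection of `f` files, each a `β × k` matrix over `F`. -/
abbrev Files (F : Type*) (k f β : ℕ) : Type _ := Fin f → Matrix (Fin β) (Fin k) F

/-- The code symbols stored on node `l`: each row of each file is encoded with `G`, and node `l`
keeps the `l`-th symbol of each of the `β f` codewords. -/
def stored {F : Type*} [Field F] {n k f β : ℕ} (G : Matrix (Fin k) (Fin n) F)
    (X : Files F k f β) (l : Fin n) : Fin f → Fin β → F :=
  fun m i => (X m * G) i l

/-- A scheme for `n` nodes and `f` files of `β` stripes in which `d l` symbols of `F` are
downloaded from node `l`. The user draws private randomness, from which, and from the index of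
the requested file, the queries are computed; the response of a node is a deterministic function
of the query it receives and of the symbols it stores. -/
structure Scheme (F : Type*) (n f β : ℕ) (d : Fin n → ℕ) where
  /-- the values of the private randomness of the user -/
  Rand : Type
  /-- the law of the private randomness -/
  law : PMF Rand
  /-- the set of possible queries to each node -/
  Query : Fin n → Type
  /-- there are finitely many possible queries -/
  fintypeQuery : ∀ l, Fintype (Query l)
  /-- the query to each node, given the requested index and the randomness -/
  query : Fin f → Rand → ∀ l, Query l
  /-- the response of each node -/
  answer : ∀ l, Query l → (Fin f → Fin β → F) → (Fin (d l) → F)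

attribute [instance] Scheme.fintypeQuery

namespace Scheme

variable {F : Type*} [Field F] {n k f β : ℕ} {d : Fin n → ℕ}

/-- The response of node `l` when file `m` is requested, the user's randomness is `s` and the
files are `X`. -/
def response (P : Scheme F n f β d) (G : Matrix (Fin k) (Fin n) F)
    (m : Fin f) (s : P.Rand) (X : Files F k f β) (l : Fin n) : Fin (d l) → F :=
  P.answer l (P.query m s l) (stored G X l)

variable [Fintype F]

/-- Joint law of `(m, (Q_l, A_l, X))`, where the requested index `m` has law `π`, the files `X`
have law `μ`, and `m`, `X` and the randomness of the user are independent. -/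
def viewLaw (P : Scheme F n f β d) (G : Matrix (Fin k) (Fin n) F)
    (π : PMF (Fin f)) (μ : PMF (Files F k f β)) (l : Fin n) :
    PMF (Fin f × (P.Query l × (Fin (d l) → F) × Files F k f β)) :=
  π.bind fun m => P.law.bind fun s => μ.map fun X =>
    (m, (P.query m s l, P.response G m s X l, X))

/-- Joint law of `(X_m, (A_1, …, A_n, Q_1, …, Q_n))` when file `m` is requested, where the files
`X` have law `μ` and are independent of the randomness of the user. -/
def recoveryLaw (P : Scheme F n f β d) (G : Matrix (Fin k) (Fin n) F)
    (μ : PMF (Files F k f β)) (m : Fin f) :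
    PMF (Matrix (Fin β) (Fin k) F × ((∀ l, Fin (d l) → F) × (∀ l, P.Query l))) :=
  P.law.bind fun s => μ.map fun X => (X m, (P.response G m s X, P.query m s))

/-- Perfect information-theoretic PIR with noncolluding nodes, whatever the distributions of the
requested index and of the files are:
privacy, `I(m; Q_l, A_l, X_1, …, X_f) = 0` for every node `l`, and
recovery, `H(X_m | A_1, …, A_n, Q_1, …, Q_n) = 0` for every requested file `m`. -/
def IsPerfect (P : Scheme F n f β d) (G : Matrix (Fin k) (Fin n) F) : Prop :=
  (∀ (π : PMF (Fin f)) (μ : PMF (Files F k f β)) (l : Fin n),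
      mutualInfo (P.viewLaw G π μ l) = 0) ∧
    ∀ (μ : PMF (Files F k f β)) (m : Fin f), condEntropy (P.recoveryLaw G μ m) = 0

end Scheme

/-- The PIR rate `β k / D`, with `D` the total number of downloaded symbols. -/
def rate (n k β : ℕ) (d : Fin n → ℕ) : ℝ :=
  ((β * k : ℕ) : ℝ) / ((∑ l, d l : ℕ) : ℝ)

/-- There is a perfect PIR scheme for `f` files of `β` stripes stored with `G`, in which `d l`
symbols are downloaded from node `l`. -/
def SchemeExists {F : Type*} [Field F] [Fintype F] {n k : ℕ} (G : Matrix (Fin k) (Fin n) F)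
    (f β : ℕ) (d : Fin n → ℕ) : Prop :=
  ∃ P : Scheme F n f β d, P.IsPerfect G

/-- Download profile of a scheme that uses, for each row `i`, only the nodes in `I i`: up to a
common factor, the number of symbols downloaded from node `l` is the number of rows `i` with
`l ∈ I i`. -/
def HasProfile {n ν : ℕ} (I : Fin ν → Finset (Fin n)) (d : Fin n → ℕ) : Prop :=
  ∃ c : ℕ, ∀ l, d l = c * (Finset.univ.filter fun i => l ∈ I i).card

/-- The rate `(1 - κ/ν) [1 - (κ/ν)^f]⁻¹`. -/
def rateA (κ ν f : ℕ) : ℝ :=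
  (1 - (κ : ℝ) / ν) * (1 - ((κ : ℝ) / ν) ^ f)⁻¹

end

end PIR

namespace PIR

noncomputable section

/-! Coded storage is reduced to `ν` replicated servers of which `κ` may collude. The nodes of `I i`
together play server `i`: each applies the linear functional asked of that server to what it stores,
which encodes with `G` the values of the functional on the file columns, and an information set
decodes them. Node `l` sees only the queries of the at most `κ` servers `i` with `l ∈ I i`
(`schemeExists_of_linear`).

Two linear schemes, over an extension field large enough for Vandermonde arrays, then suffice. In
`schemeExists_files_independent` the queries are an MDS encoding of `κ` random vectors, with
requested symbols added at the servers `i ≥ κ`; the first `κ` answers determine the interference, so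
the rate is `1 - κ/ν`.

In `schemeExists_words` queries are indexed by words with one letter per file, and a file takes part
only if its letter is at least `κ`. Interference is MDS coded along the letter of the requested
file: letters below `κ` reveal it, the others carry requested symbols. Words with all letters below
`κ` ask for nothing and are omitted. So `ν^f (ν - κ)` symbols are retrieved with `ν (ν^f - κ^f)`
answers. Privacy comes from independent random automorphisms, one per file, because any `κ` servers
see linearly independent vectors whichever file is requested (`linearIndependent_wordQuery`). -/

/-! ### Entropy criteria for privacy and recovery -/

lemma entropy_map_of_injective {α γ : Type*} [Fintype α] [Fintype γ] (p : PMF α) {g : α → γ}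
    (hg : Function.Injective g) : entropy (p.map g) = entropy p := by
  classical
  have happ : ∀ a, p.map g (g a) = p a := fun a => by
    rw [PMF.map_apply, tsum_eq_single a]
    · simp
    · intro b hb
      rw [if_neg]
      exact fun h => hb (hg h).symm
  unfold entropy
  rw [← Finset.sum_subset (Finset.subset_univ (Finset.univ.image g)),
    Finset.sum_image hg.injOn]
  · simp only [happ]
  · intro b _ hb
    have : p.map g b = 0 := by
      rw [PMF.apply_eq_zero_iff, PMF.mem_support_map_iff]
      rintro ⟨a, -, rfl⟩
      exact hb (Finset.mem_image_of_mem _ (Finset.mem_univ _))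
    simp [this]

lemma sum_toReal_eq_one {α : Type*} [Fintype α] (p : PMF α) : ∑ a, (p a).toReal = 1 := by
  rw [← ENNReal.toReal_sum fun a _ => p.apply_ne_top a, ← tsum_fintype (L := .unconditional α),
    p.tsum_coe]
  rfl

/-- The joint law of two independent random variables carries no mutual information. -/
lemma mutualInfo_bind_map {α γ : Type*} [Fintype α] [Fintype γ] (p : PMF α) (q : PMF γ) :
    mutualInfo (p.bind fun a => q.map (Prod.mk a)) = 0 := by
  classical
  have h1 : (p.bind fun a => q.map (Prod.mk a)).map Prod.fst = p := by
    rw [PMF.map_bind]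
    have : ∀ a : α, (q.map (Prod.mk a)).map Prod.fst = PMF.pure a := fun a => by
      rw [PMF.map_comp]
      exact PMF.map_const q a
    simp [this]
  have h2 : (p.bind fun a => q.map (Prod.mk a)).map Prod.snd = q := by
    rw [PMF.map_bind]
    have : ∀ a : α, (q.map (Prod.mk a)).map Prod.snd = q := fun a => by
      rw [PMF.map_comp]
      exact PMF.map_id q
    simp [this]
  have h3 : ∀ a c, (p.bind fun a => q.map (Prod.mk a)) (a, c) = p a * q c := fun a c => by
    rw [PMF.bind_apply, tsum_eq_single a]
    · rw [PMF.map_apply, tsum_eq_single c]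
      · simp
      · intro b hb
        simp [Ne.symm hb]
    · intro b hb
      have : q.map (Prod.mk b) (a, c) = 0 := by
        rw [PMF.apply_eq_zero_iff, PMF.mem_support_map_iff]
        rintro ⟨x, -, hx⟩
        exact hb (congrArg Prod.fst hx)
      simp [this]
  unfold mutualInfo
  rw [h1, h2]
  unfold entropy
  rw [Fintype.sum_prod_type]
  simp only [h3, ENNReal.toReal_mul, Real.negMulLog_mul, Finset.sum_add_distrib]
  simp only [← Finset.sum_mul, ← Finset.mul_sum, sum_toReal_eq_one]
  ring

/-- If the first coordinate is a function of the second one on the support of the joint law, then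
its conditional entropy vanishes. -/
lemma condEntropy_eq_zero {α γ : Type*} [Fintype α] [Fintype γ] (p : PMF (α × γ))
    (h : ∀ u ∈ p.support, ∀ v ∈ p.support, u.2 = v.2 → u.1 = v.1) : condEntropy p = 0 := by
  classical
  obtain ⟨a₀, -⟩ := p.support_nonempty
  -- A section of the second projection; off the support the value `a₀.1` is arbitrary.
  let g : γ → α × γ := fun c =>
    (if hc : ∃ u ∈ p.support, u.2 = c then hc.choose.1 else a₀.1, c)
  have hg : Function.Injective g := fun c c' hcc => congrArg Prod.snd hcc
  have hgp : ∀ u ∈ p.support, g u.2 = u := fun u hu => by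
    have hc : ∃ v ∈ p.support, v.2 = u.2 := ⟨u, hu, rfl⟩
    refine Prod.ext ?_ rfl
    simp only [g, dif_pos hc]
    exact h _ hc.choose_spec.1 _ hu hc.choose_spec.2
  have hp : (p.map Prod.snd).map g = p := by
    rw [PMF.map_comp]
    conv_rhs => rw [← PMF.bind_pure p]
    rw [PMF.map]
    ext b
    simp only [PMF.bind_apply]
    refine tsum_congr fun u => ?_
    by_cases hu : u ∈ p.support
    · simp [hgp u hu]
    · rw [(PMF.apply_eq_zero_iff p u).2 hu, zero_mul, zero_mul]
  unfold condEntropy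
  rw [← entropy_map_of_injective _ hg, hp, sub_self]

namespace Scheme

variable {F : Type*} [Field F] [Fintype F] {n k f β : ℕ} {d : Fin n → ℕ}

/-- A scheme is perfect as soon as the law of each query does not depend on the requested index,
and the requested file is determined by the randomness and the responses. -/
lemma isPerfect_of (P : Scheme F n f β d) (G : Matrix (Fin k) (Fin n) F)
    (hpriv : ∀ l m m', P.law.map (fun s => P.query m s l) = P.law.map fun s => P.query m' s l)
    (hrec : ∀ m s X X', P.response G m s X = P.response G m s X' → X m = X' m) :
    P.IsPerfect G := by
  refine ⟨fun π μ l => ?_, fun μ m => condEntropy_eq_zero _ ?_⟩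
  · obtain ⟨m₀, -⟩ := π.support_nonempty
    -- Answers depend on the user only through the query, so the view given `m` has the law it has
    -- for `m₀`.
    have key : ∀ m, (P.law.bind fun s => μ.map fun X =>
        (m, (P.query m s l, P.response G m s X l, X))) =
        ((P.law.map fun s => P.query m₀ s l).bind fun Q => μ.map fun X =>
          (Q, P.answer l Q (stored G X l), X)).map (Prod.mk m) := fun m => by
      rw [hpriv l m₀ m, PMF.bind_map, PMF.map_bind]
      refine congrArg _ (funext fun s => ?_)
      simp only [Function.comp_apply]
      rw [PMF.map_comp]
      rfl
    unfold viewLaw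
    simp only [key]
    exact mutualInfo_bind_map _ _
  · rintro ⟨a, A, Q⟩ hu ⟨a', A', Q'⟩ hv huv
    simp only [recoveryLaw, PMF.mem_support_bind_iff, PMF.mem_support_map_iff,
      Prod.mk.injEq] at hu hv huv
    obtain ⟨s, -, X, -, rfl, rfl, rfl⟩ := hu
    obtain ⟨s', -, X', -, rfl, rfl, rfl⟩ := hv
    refine hrec m s X X' ?_
    rw [huv.1]
    funext l
    simp only [response, huv.2]

end Scheme

/-! ### From replicated servers to coded storage -/

/-- Multiply by the inverse of the submatrix on `I`. The entries lie in a module because decoding is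
applied to answers in the extension field. -/
lemma IsInformationSet.eq_zero {F M : Type*} [Field F] [AddCommGroup M] [Module F M] {n k : ℕ}
    {G : Matrix (Fin k) (Fin n) F} {I : Finset (Fin n)} (hI : IsInformationSet G I)
    (x : Fin k → M) (hx : ∀ l ∈ I, ∑ a, G a l • x a = 0) : x = 0 := by
  obtain ⟨e, he⟩ := hI
  set A := G.submatrix id fun j => (e j : Fin n) with hA
  have hAA : A * A⁻¹ = 1 := Matrix.mul_nonsing_inv A ((Matrix.isUnit_iff_isUnit_det A).1 he)
  funext b
  calc x b = ∑ a, (A * A⁻¹) a b • x a := by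
        simp [hAA, Matrix.one_apply, ite_smul]
    _ = ∑ j, A⁻¹ j b • ∑ a, A a j • x a := by
        simp only [Matrix.mul_apply, Finset.sum_smul, Finset.smul_sum, smul_smul]
        rw [Finset.sum_comm]
        simp only [mul_comm]
    _ = 0 := Finset.sum_eq_zero fun j _ => by
        rw [show ∑ a, A a j • x a = 0 from hx _ (e j).2, smul_zero]

/-- A linear private information retrieval scheme over an extension field `E` for `ν` replicated
servers, private against each group `{i | l ∈ I i}` of servers, gives a scheme for the coded
storage system, where the nodes of the information set `I i` act jointly as server `i`. -/
theorem schemeExists_of_linear {E : Type} {F : Type*} [Field F] [Fintype F] [Field E] [Fintype E]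
    [Algebra F E] {n k ν f : ℕ} {G : Matrix (Fin k) (Fin n) F} {I : Fin ν → Finset (Fin n)}
    (hI : ∀ i, IsInformationSet G (I i)) {L τ R : Type} [Fintype L] [Fintype τ] [Fintype R]
    [Nonempty R] (q : Fin f → R → Fin ν → τ → Fin f → L → E)
    (hpriv : ∀ l m m', ∃ σ : R ≃ R, ∀ s i, l ∈ I i → q m s i = q m' (σ s) i)
    (hrec : ∀ m s (x : Fin f → L → E),
      (∀ i t, ∑ m', ∑ j, q m s i t m' j * x m' j = 0) → x m = 0) :
    SchemeExists G f (Module.finrank F E * Fintype.card L)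
      (fun l => Module.finrank F E * Fintype.card τ *
        (Finset.univ.filter fun i => l ∈ I i).card) := by
  classical
  -- The stripes of one file column become a vector over `E`; `F`-linearity suffices because `G` has
  -- entries in `F`.
  have hA : Nonempty ((Fin (Module.finrank F E * Fintype.card L) → F) ≃ₗ[F] (L → E)) := by
    refine FiniteDimensional.nonempty_linearEquiv_of_finrank_eq ?_
    simp [Module.finrank_pi_fintype, mul_comm]
  have hD : ∀ l, Nonempty (({i // l ∈ I i} → τ → E) ≃ₗ[F]
      (Fin (Module.finrank F E * Fintype.card τ *
        (Finset.univ.filter fun i => l ∈ I i).card) → F)) := fun l => by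
    refine FiniteDimensional.nonempty_linearEquiv_of_finrank_eq ?_
    simp [Module.finrank_pi_fintype, Fintype.card_subtype]
    ring
  obtain ⟨A⟩ := hA
  let D := fun l => (hD l).some
  let P : Scheme F n f (Module.finrank F E * Fintype.card L)
      (fun l => Module.finrank F E * Fintype.card τ *
        (Finset.univ.filter fun i => l ∈ I i).card) :=
    { Rand := R
      law := PMF.uniformOfFintype R
      Query := fun l => {i // l ∈ I i} → τ → Fin f → L → E
      fintypeQuery := fun l => inferInstance
      query := fun m s l i => q m s i
      answer := fun l Q y => D l fun i t => ∑ m', ∑ j, Q i t m' j * A (y m') j }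
  refine ⟨P, P.isPerfect_of G (fun l m m' => ?_) fun m s X X' h => ?_⟩
  · obtain ⟨σ, hσ⟩ := hpriv l m m'
    have h1 : (fun s => P.query m s l) = (fun s => P.query m' s l) ∘ σ := by
      funext s i
      exact hσ s i i.2
    have h2 : P.law.map σ = P.law := by
      ext s
      rw [PMF.map_apply, tsum_eq_single (σ.symm s)]
      · simp [P]
      · intro b hb
        rw [if_neg]
        rintro rfl
        simp at hb
    rw [h1, ← PMF.map_comp, h2]
  -- By linearity, only the difference of two file collections with equal responses matters; each of
  -- its columns is treated separately.
  · let x : Fin k → Fin f → L → E := fun a m' => A fun i => X m' i a - X' m' i a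
    have hst : ∀ l m' j, A (stored G X l m') j - A (stored G X' l m') j =
        ∑ a, G a l • x a m' j := fun l m' j => by
      have h1 : stored G X l m' - stored G X' l m' =
          ∑ a, G a l • fun i => X m' i a - X' m' i a := by
        funext i
        simp only [stored, Matrix.mul_apply, Pi.sub_apply, Finset.sum_apply, Pi.smul_apply,
          smul_eq_mul, ← Finset.sum_sub_distrib]
        exact Finset.sum_congr rfl fun a _ => by ring
      rw [← Pi.sub_apply, ← map_sub, h1, map_sum, Finset.sum_apply]
      exact Finset.sum_congr rfl fun a _ => by rw [map_smul]; rfl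
    have hx : ∀ a, x a m = 0 := fun a => by
      refine hrec m s (x a) fun i t => ?_
      refine congrFun ((hI i).eq_zero (fun a => ∑ m', ∑ j, q m s i t m' j * x a m' j)
        fun l hl => ?_) a
      have h1 := congrFun (congrFun ((D l).injective (congrFun h l)) ⟨i, hl⟩) t
      have h2 : ∑ m', ∑ j, q m s i t m' j * (A (stored G X l m') j - A (stored G X' l m') j) =
          0 := by
        simp only [mul_sub, Finset.sum_sub_distrib]
        exact sub_eq_zero.2 h1
      rw [← h2]
      simp only [hst, Finset.smul_sum, Finset.mul_sum, mul_smul_comm]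
      rw [Finset.sum_comm]
      exact Finset.sum_congr rfl fun m' _ => Finset.sum_comm
    ext i a
    have := congrFun (A.injective ((hx a).trans (map_zero A).symm)) i
    exact sub_eq_zero.1 this

/-! ### Linear algebra of MDS arrays -/

/-- Two linearly independent families are related by an automorphism. -/
lemma exists_linearEquiv_of_linearIndependent {K V ι : Type*} [Field K] [AddCommGroup V]
    [Module K V] [FiniteDimensional K V] {v w : ι → V} (hv : LinearIndependent K v)
    (hw : LinearIndependent K w) : ∃ g : V ≃ₗ[K] V, ∀ i, g (v i) = w i := by
  obtain ⟨g, hg⟩ := Submodule.exists_linearEquiv_restrict_eq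
    (hv.linearCombinationEquiv.symm ≪≫ₗ hw.linearCombinationEquiv)
  refine ⟨g, fun i => ?_⟩
  rw [← hg ⟨v i, Submodule.subset_span ⟨i, rfl⟩⟩]
  have : hv.linearCombinationEquiv.symm ⟨v i, Submodule.subset_span ⟨i, rfl⟩⟩ =
      Finsupp.single i 1 := by
    rw [LinearEquiv.symm_apply_eq]
    ext
    simp
  simp [this]

/-- Over a large enough field there is an array of which any `|Z| ≤ |Y|` rows are linearly
independent. -/
lemma exists_array {E R Y : Type*} [Field E] [Fintype E] [Fintype R] [Fintype Y]
    (h : Fintype.card R ≤ Fintype.card E) : ∃ V : R → Y → E, ∀ s : Finset R,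
      s.card ≤ Fintype.card Y → LinearIndependent E fun r : s => V r := by
  classical
  obtain ⟨α⟩ := Function.Embedding.nonempty_of_card_le h
  refine ⟨fun r y => α r ^ (Fintype.equivFin Y y : ℕ), fun s hs => ?_⟩
  rw [Fintype.linearIndependent_iff]
  intro c hc
  let e := s.equivFin
  have := Matrix.eq_zero_of_forall_pow_sum_mul_pow_eq_zero
    (f := fun j => α (e.symm j)) (v := fun j => c (e.symm j))
    (fun a b hab => e.symm.injective (Subtype.ext (α.injective hab))) fun i => by
      have := congrFun hc ((Fintype.equivFin Y).symm ⟨i, i.2.trans_le hs⟩)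
      rw [← e.symm.sum_comp] at this
      simpa using this
  intro r
  simpa using congrFun this (e r)

/-- An array with linearly independent rows is right invertible. -/
lemma exists_sum_smul_eq {E Z Y M : Type*} [Field E] [Fintype Z] [Fintype Y] [AddCommGroup M]
    [Module E M] {V : Z → Y → E} (hV : LinearIndependent E V) (t : Z → M) :
    ∃ δ : Y → M, ∀ z, ∑ y, V z y • δ y = t z := by
  classical
  obtain ⟨B, hB⟩ : ∃ B : Matrix Y Z E, Matrix.of V * B = 1 := by
    have hinj : LinearMap.ker (Fintype.linearCombination E V) = ⊥ :=
      LinearMap.ker_eq_bot'.2 fun c hc => funext (Fintype.linearIndependent_iff.1 hV c hc)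
    obtain ⟨g, hg⟩ := LinearMap.exists_leftInverse_of_injective _ hinj
    refine ⟨Matrix.of fun y => g (Pi.single y 1), ?_⟩
    ext z w
    have h1 : V z = ∑ y, V z y • (Pi.single y 1 : Y → E) := by
      funext y
      simp [Pi.single_apply]
    have h2 := congrFun (LinearMap.congr_fun hg (Pi.single z 1)) w
    rw [LinearMap.comp_apply, Fintype.linearCombination_apply_single, one_smul, h1, map_sum] at h2
    simp only [map_smul, Finset.sum_apply, Pi.smul_apply, smul_eq_mul, LinearMap.id_apply] at h2
    rw [Matrix.mul_apply, Matrix.one_apply]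
    simpa [Pi.single_apply, eq_comm] using h2
  refine ⟨fun y => ∑ z, B y z • t z, fun z => ?_⟩
  simp only [Finset.smul_sum, smul_smul]
  rw [Finset.sum_comm]
  simp only [← Finset.sum_smul]
  have : ∀ w, ∑ y, V z y * B y w = (1 : Matrix Z Z E) z w := fun w => by
    rw [← hB]; rfl
  simp [this, Matrix.one_apply, ite_smul]

/-- An array with as many linearly independent rows as columns is left invertible. -/
lemma eq_zero_of_sum_smul_eq_zero {E Z Y M : Type*} [Field E] [Fintype Z] [Fintype Y]
    [AddCommGroup M] [Module E M] {V : Z → Y → E} (hV : LinearIndependent E V)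
    (h : Fintype.card Z = Fintype.card Y) (B : Y → M) (hB : ∀ z, ∑ y, V z y • B y = 0) :
    B = 0 := by
  classical
  obtain ⟨δ, hδ⟩ := exists_sum_smul_eq hV (fun z => (Pi.single z 1 : Z → E))
  have h1 : Matrix.of V * Matrix.of δ = 1 := by
    ext z w
    have := congrFun (hδ z) w
    simp only [Finset.sum_apply, Pi.smul_apply, smul_eq_mul] at this
    rw [Matrix.mul_apply, Matrix.one_apply]
    simpa [Pi.single_apply, eq_comm] using this
  have h2 := (Matrix.mul_eq_one_comm_of_card_eq _ _ _ h).1 h1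
  funext y
  calc B y = ∑ w, (Matrix.of δ * Matrix.of V) y w • B w := by
        simp [h2, Matrix.one_apply, ite_smul]
    _ = ∑ z, δ y z • ∑ w, V z w • B w := by
        simp only [Matrix.mul_apply, Finset.sum_smul, Finset.smul_sum, smul_smul]
        rw [Finset.sum_comm]
        rfl
    _ = 0 := by simp [hB]

/-! ### The scheme with file size independent of the number of files -/

section Schemes

variable {F : Type*} [Field F] [Fintype F] {n k κ ν : ℕ} {G : Matrix (Fin k) (Fin n) F}
  {I : Fin ν → Finset (Fin n)}

lemma card_filter_val_lt (h : κ ≤ ν) : (Finset.univ.filter fun i : Fin ν => i.val < κ).card = κ := by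
  rw [Fin.card_filter_val_lt, min_eq_right h]

/-- Servers `i < κ` return pure interference, the other ones return a symbol of the requested file
on top of an interference that is determined by the responses of the first `κ` servers. -/
theorem schemeExists_files_independent {E : Type} [Field E] [Fintype E] [Algebra F E]
    (hI : ∀ i, IsInformationSet G (I i))
    (hcard : ∀ l, (Finset.univ.filter fun i => l ∈ I i).card ≤ κ) (hκν : κ ≤ ν)
    (hE : ν ≤ Fintype.card E) (f : ℕ) :
    SchemeExists G f (Module.finrank F E * (ν - κ))
      (fun l => Module.finrank F E * (Finset.univ.filter fun i => l ∈ I i).card) := by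
  classical
  obtain ⟨V, hV⟩ := exists_array (E := E) (R := Fin ν) (Y := Fin κ) (by simpa using hE)
  let L := {i : Fin ν // ¬ i.val < κ}
  have hL : Fintype.card L = ν - κ := by
    rw [Fintype.card_subtype_compl, Fintype.card_subtype, card_filter_val_lt hκν, Fintype.card_fin]
  let d : Fin f → Fin ν → Fin f → L → E := fun m i m' j => if m' = m ∧ j.val = i then 1 else 0
  have := schemeExists_of_linear (F := F) (E := E) (f := f) (L := L) (τ := Unit)
    (R := Fin κ → Fin f → L → E) hI (fun m s i _ => ∑ y, V i y • s y + d m i) ?_ ?_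
  · simpa [hL] using this
  · intro l m m'
    -- The node sees at most `κ` independent rows, so a shift of the randomness absorbs the change
    -- of request.
    obtain ⟨δ, hδ⟩ := exists_sum_smul_eq
      (hV (Finset.univ.filter fun i => l ∈ I i) ((hcard l).trans_eq (by simp)))
      (fun i => d m i - d m' i)
    refine ⟨Equiv.addRight δ, fun s i hi => funext fun _ => ?_⟩
    have := hδ ⟨i, by simpa using hi⟩
    simp only [Equiv.coe_addRight, Pi.add_apply, smul_add, Finset.sum_add_distrib, this]
    abel
  · intro m s x hx
    let φ : (Fin f → L → E) → E := fun z => ∑ m', ∑ j, z m' j * x m' j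
    have hφ : ∀ i, ∑ y, V i y • φ (s y) + φ (d m i) = 0 := fun i => by
      rw [← hx i ()]
      simp only [φ, Pi.add_apply, Finset.sum_apply, Pi.smul_apply, smul_eq_mul, add_mul,
        Finset.sum_add_distrib, Finset.sum_mul, Finset.mul_sum]
      congr 1
      rw [Finset.sum_comm]
      refine Finset.sum_congr rfl fun m' _ => ?_
      rw [Finset.sum_comm]
      exact Finset.sum_congr rfl fun j _ => Finset.sum_congr rfl fun y _ => by ring
    have hd : ∀ i, i.val < κ → φ (d m i) = 0 := fun i hi => by
      refine Finset.sum_eq_zero fun m' _ => Finset.sum_eq_zero fun j _ => ?_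
      have : ¬ (m' = m ∧ j.val = i) := by
        rintro ⟨-, rfl⟩
        exact j.2 hi
      simp [d, this]
    have hs : (fun y => φ (s y)) = 0 := by
      refine eq_zero_of_sum_smul_eq_zero
        (hV (Finset.univ.filter fun i : Fin ν => i.val < κ) ?_) ?_ _ fun i => ?_
      · simp [card_filter_val_lt hκν]
      · rw [Fintype.card_coe, card_filter_val_lt hκν, Fintype.card_fin]
      · have := hφ i
        rwa [hd i (Finset.mem_filter.1 i.2).2, add_zero] at this
    funext j
    have h := hφ j
    simp only [congrFun hs, Pi.zero_apply, smul_zero, Finset.sum_const_zero, zero_add] at h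
    rw [Pi.zero_apply, ← h]
    simp only [φ, d]
    rw [Finset.sum_eq_single m, Finset.sum_eq_single j]
    · simp
    · intro b _ hb
      simp [Subtype.val_inj, hb]
    · simp
    · intro b _ hb
      simp [hb]
    · simp

end Schemes

/-! ### The scheme indexed by words -/

open Function in
lemma update_eq_update_iff {ι A : Type*} [DecidableEq ι] {u v : ι → A} {m : ι} (h : u m = v m)
    (a b : A) : update u m a = update v m b ↔ u = v ∧ a = b := by
  constructor
  · intro h'
    refine ⟨funext fun j => ?_, by simpa using congrFun h' m⟩
    by_cases hj : j = m
    · rw [hj, h]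
    · simpa [hj] using congrFun h' j
  · rintro ⟨rfl, rfl⟩
    rfl

section Words

variable {E : Type*} [Field E] {f κ ν : ℕ}

/-- Indices of the symbols of a file: `(u, x)` stands for the symbol that is requested from server
`u m` by the word obtained from `u` by putting the letter `x` at position `m`. -/
abbrev SymbolIndex (f κ ν : ℕ) : Type := (Fin f → Fin ν) × {x : Fin ν // ¬ x.val < κ}

/-- The symbol of file `m` requested from server `i` by the word `w`, zero if the `m`-th letter of
`w` is less than `κ`. -/
def unitQuery (E : Type*) [Field E] (m : Fin f) (i : Fin ν) (w : Fin f → Fin ν) :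
    SymbolIndex f κ ν → E :=
  fun p => if p.2.val = w m ∧ p.1 = Function.update w m i then 1 else 0

/-- The part concerning file `m'` of the query to server `i` with word `w`, before randomization,
when file `m` is requested. -/
def wordQuery (hκν : κ ≤ ν) (V : Fin ν × Fin ν → Fin ν × Fin κ → E) (m m' : Fin f) (i : Fin ν)
    (w : Fin f → Fin ν) : SymbolIndex f κ ν → E :=
  if m' = m then unitQuery E m' i w else
    ∑ y, V (i, w m) y • unitQuery E m' y.1 (Function.update w m (Fin.castLE hκν y.2))

lemma unitQuery_eq_zero {m : Fin f} {w : Fin f → Fin ν} (h : (w m).val < κ) (i : Fin ν) :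
    unitQuery (κ := κ) E m i w = 0 := by
  funext p
  have : ¬ (p.2.val = w m ∧ p.1 = Function.update w m i) := by
    rintro ⟨hp, -⟩
    exact p.2.2 (hp ▸ h)
  simp [unitQuery, this]

/-- The condition does not involve the requested index `m`, so the pattern of zero queries leaks
nothing. -/
lemma wordQuery_eq_zero (hκν : κ ≤ ν) (V : Fin ν × Fin ν → Fin ν × Fin κ → E) (m : Fin f)
    {m' : Fin f} {w : Fin f → Fin ν} (h : (w m').val < κ) (i : Fin ν) :
    wordQuery hκν V m m' i w = 0 := by
  unfold wordQuery
  split_ifs with hm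
  · exact unitQuery_eq_zero h i
  · refine Finset.sum_eq_zero fun y _ => ?_
    rw [unitQuery_eq_zero, smul_zero]
    rwa [Function.update_of_ne hm]

lemma unitQuery_update (m : Fin f) (p : SymbolIndex f κ ν) :
    unitQuery E m (p.1 m) (Function.update p.1 m p.2) = Pi.single p 1 := by
  funext p'
  simp [unitQuery, Pi.single_apply, Prod.ext_iff, Subtype.ext_iff, and_comm]

/-- For the requested file the vectors are distinct basis vectors. For another file, words that
differ off position `m` involve disjoint coordinates, and words that agree there give at most `κ ν`
rows of `V`. -/
lemma linearIndependent_wordQuery (hκν : κ ≤ ν) {V : Fin ν × Fin ν → Fin ν × Fin κ → E}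
    (hV : ∀ s : Finset (Fin ν × Fin ν), s.card ≤ Fintype.card (Fin ν × Fin κ) →
      LinearIndependent E fun r : s => V r)
    {S : Finset (Fin ν)} (hS : S.card ≤ κ) (m m' : Fin f) :
    LinearIndependent E
      fun p : {p : Fin ν × (Fin f → Fin ν) // p.1 ∈ S ∧ ¬ (p.2 m').val < κ} =>
        wordQuery hκν V m m' p.1.1 p.1.2 := by
  classical
  by_cases hm : m' = m
  · let e : {p : Fin ν × (Fin f → Fin ν) // p.1 ∈ S ∧ ¬ (p.2 m').val < κ} → SymbolIndex f κ ν :=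
      fun p => (Function.update p.1.2 m' p.1.1, ⟨p.1.2 m', p.2.2⟩)
    have he : Function.Injective e := fun p p' h => by
      simp only [e, Prod.mk.injEq, Subtype.mk.injEq] at h
      obtain ⟨h1, h2⟩ := (update_eq_update_iff h.2 _ _).1 h.1
      exact Subtype.ext (Prod.ext h2 h1)
    convert (Pi.basisFun E (SymbolIndex f κ ν)).linearIndependent.comp e he using 1
    funext p
    rw [wordQuery, if_pos hm, Function.comp_apply, Pi.basisFun_apply, ← unitQuery_update m']
    simp [e]
  · rw [Fintype.linearIndependent_iff]
    intro c hc ⟨⟨i₀, w₀⟩, hi₀, hw₀⟩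
    have hs : (S ×ˢ (Finset.univ : Finset (Fin ν))).card ≤ Fintype.card (Fin ν × Fin κ) := by
      simp only [Finset.card_product, Finset.card_univ, Fintype.card_fin, Fintype.card_prod]
      rw [mul_comm]
      gcongr
    -- These coordinates isolate the words that agree with `w₀` off position `m`.
    have hproj : ∀ (i : Fin ν) (w : Fin f → Fin ν) (y : Fin ν × Fin κ),
        wordQuery hκν V m m' i w
          (Function.update (Function.update w₀ m (Fin.castLE hκν y.2)) m' y.1, ⟨w₀ m', hw₀⟩) =
        if w = Function.update w₀ m (w m) ∧ w m' = w₀ m' then V (i, w m) y else 0 := by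
      intro i w y
      rw [wordQuery, if_neg hm, Finset.sum_apply]
      simp only [Pi.smul_apply, unitQuery, Function.update_of_ne hm, smul_eq_mul]
      split_ifs with h
      · have hw : ∀ z, Function.update w m z = Function.update w₀ m z := fun z => by
          rw [h.1, Function.update_idem]
        rw [Finset.sum_eq_single y]
        · simp [hw, h.2]
        · intro y' _ hy'
          rw [if_neg, mul_zero]
          rintro ⟨-, h'⟩
          rw [hw, update_eq_update_iff (by simp [hm]), update_eq_update_iff rfl] at h'
          exact hy' (Prod.ext h'.2.symm (Fin.castLE_injective hκν h'.1.2.symm))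
        · simp
      · refine Finset.sum_eq_zero fun y' _ => ?_
        rw [if_neg, mul_zero]
        rintro ⟨h1, h'⟩
        rw [update_eq_update_iff (by simp [hm, h1])] at h'
        refine h ⟨?_, h1.symm⟩
        have := congrArg (fun u => Function.update u m (w m)) h'.1
        simpa using this.symm
    let e : (S ×ˢ (Finset.univ : Finset (Fin ν)) : Finset _) →
        {p : Fin ν × (Fin f → Fin ν) // p.1 ∈ S ∧ ¬ (p.2 m').val < κ} := fun r =>
      ⟨(r.1.1, Function.update w₀ m r.1.2), (Finset.mem_product.1 r.2).1, by
        simpa [hm] using hw₀⟩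
    have he : Function.Injective e := fun r r' h => by
      simp only [e, Subtype.mk.injEq, Prod.mk.injEq, update_eq_update_iff rfl] at h
      exact Subtype.ext (Prod.ext h.1 h.2.2)
    have hsum : ∑ r, c (e r) • V r = 0 := by
      funext y
      refine Eq.trans ?_ (congrFun hc (Function.update (Function.update w₀ m (Fin.castLE hκν y.2))
        m' y.1, ⟨w₀ m', hw₀⟩))
      simp only [Finset.sum_apply, Pi.smul_apply, hproj]
      refine Fintype.sum_of_injective e he _ _ ?_ ?_
      · intro p hp
        rw [if_neg, smul_zero]
        rintro ⟨h, -⟩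
        refine hp ⟨⟨(p.1.1, p.1.2 m), by simpa using p.2.1⟩, Subtype.ext (Prod.ext rfl h.symm)⟩
      · intro r
        simp [e, hm]
    have := Fintype.linearIndependent_iff.1 (hV _ hs) (fun r => c (e r)) hsum
      ⟨(i₀, w₀ m), by simpa using hi₀⟩
    simpa [e] using this

/-- The queries are indexed by the words with at least one letter that is not less than `κ`; the
files of the corresponding positions contribute to the response. -/
theorem schemeExists_words {F : Type*} {E : Type} [Field F] [Fintype F] [Field E] [Fintype E]
    [Algebra F E] {n k : ℕ} {G : Matrix (Fin k) (Fin n) F} {I : Fin ν → Finset (Fin n)}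
    (hI : ∀ i, IsInformationSet G (I i))
    (hcard : ∀ l, (Finset.univ.filter fun i => l ∈ I i).card ≤ κ) (hκν : κ ≤ ν)
    (hE : ν * ν ≤ Fintype.card E) (f : ℕ) :
    SchemeExists G f (Module.finrank F E * (ν ^ f * (ν - κ)))
      (fun l => Module.finrank F E * (ν ^ f - κ ^ f) *
        (Finset.univ.filter fun i => l ∈ I i).card) := by
  classical
  obtain ⟨V, hV⟩ := exists_array (E := E) (R := Fin ν × Fin ν) (Y := Fin ν × Fin κ)
    (by simpa using hE)
  let τ := {w : Fin f → Fin ν // ¬ ∀ m, (w m).val < κ}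
  have hτ : Fintype.card τ = ν ^ f - κ ^ f := by
    have h : Fintype.card {w : Fin f → Fin ν // ∀ m, (w m).val < κ} = κ ^ f := by
      have e : {w : Fin f → Fin ν // ∀ m, (w m).val < κ} ≃ (Fin f → {i : Fin ν // i.val < κ}) :=
        Equiv.subtypePiEquivPi (p := fun (_ : Fin f) (i : Fin ν) => i.val < κ)
      rw [Fintype.card_congr e]
      simp [Fintype.card_subtype, card_filter_val_lt hκν]
    rw [Fintype.card_subtype_compl, h]
    simp
  have hL : Fintype.card (SymbolIndex f κ ν) = ν ^ f * (ν - κ) := by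
    rw [Fintype.card_prod, Fintype.card_subtype_compl, Fintype.card_subtype,
      card_filter_val_lt hκν]
    simp
  let U := SymbolIndex f κ ν → E
  have : Finite (U ≃ₗ[E] U) := DFunLike.finite _
  have : Fintype (U ≃ₗ[E] U) := Fintype.ofFinite _
  have := schemeExists_of_linear (F := F) (E := E) (f := f) (L := SymbolIndex f κ ν) (τ := τ)
    (R := Fin f → (U ≃ₗ[E] U)) hI (fun m s i w m' => s m' (wordQuery hκν V m m' i w.1)) ?_ ?_
  · rwa [hL, hτ] at this
  · intro l m₁ m₂
    have hg := fun m' => exists_linearEquiv_of_linearIndependent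
      (linearIndependent_wordQuery hκν hV (hcard l) m₂ m')
      (linearIndependent_wordQuery hκν hV (hcard l) m₁ m')
    choose g hg using hg
    -- Composition with the fixed automorphisms `g` permutes the random ones.
    refine ⟨Equiv.mulRight g, fun s i hi => funext fun w => funext fun m' => ?_⟩
    change _ = s m' (g m' _)
    by_cases hw : (w.1 m').val < κ
    · simp only [wordQuery_eq_zero hκν V _ hw, map_zero]
    · rw [← hg m' ⟨(i, w.1), by simpa using hi, hw⟩]
  · intro m s x hx
    let φ : Fin f → U →ₗ[E] E := fun m' =>
      (Fintype.linearCombination E (x m')).comp (s m').toLinearMap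
    have hφ : ∀ m' z, φ m' z = ∑ j, s m' z j * x m' j := fun m' z => by
      simp [φ, Fintype.linearCombination_apply]
    have hx' : ∀ i w, ∑ m', φ m' (wordQuery hκν V m m' i w) = 0 := fun i w => by
      by_cases hw : ∀ m, (w m).val < κ
      · exact Finset.sum_eq_zero fun m' _ => by
          rw [wordQuery_eq_zero hκν V _ (hw m'), map_zero]
      · simpa only [hφ] using hx i ⟨w, hw⟩
    -- The interference before MDS coding; it does not depend on the letter `w m`.
    let B : (Fin f → Fin ν) → Fin ν × Fin κ → E := fun w y =>
      ∑ m' ∈ Finset.univ.erase m,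
        φ m' (unitQuery E m' y.1 (Function.update w m (Fin.castLE hκν y.2)))
    have hsplit : ∀ i w, φ m (unitQuery E m i w) + ∑ y, V (i, w m) y • B w y = 0 := fun i w => by
      rw [← hx' i w, ← Finset.add_sum_erase _ _ (Finset.mem_univ m)]
      congr 1
      · simp [wordQuery]
      · simp only [B, Finset.smul_sum]
        rw [Finset.sum_comm]
        refine Finset.sum_congr rfl fun m' hm' => ?_
        rw [wordQuery, if_neg (Finset.ne_of_mem_erase hm'), map_sum]
        simp only [map_smul]
    -- Letters below `κ` at position `m` silence the requested file: `ν` servers and `κ` letters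
    -- give `ν κ` independent equations in the `ν κ` unknowns.
    have hB : ∀ w, B w = 0 := fun w => by
      have hs : ((Finset.univ : Finset (Fin ν)) ×ˢ
          Finset.univ.filter fun i : Fin ν => i.val < κ).card = Fintype.card (Fin ν × Fin κ) := by
        rw [Finset.card_product, card_filter_val_lt hκν]
        simp
      refine eq_zero_of_sum_smul_eq_zero (hV _ hs.le) (by rw [Fintype.card_coe, hs]) _ fun r => ?_
      have hr : (r.1.2).val < κ := (Finset.mem_filter.1 (Finset.mem_product.1 r.2).2).2
      have h := hsplit r.1.1 (Function.update w m r.1.2)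
      rw [unitQuery_eq_zero (by simpa using hr), map_zero, zero_add] at h
      simpa [B] using h
    have hzero : φ m = 0 := by
      refine LinearMap.pi_ext' fun p => LinearMap.ext_ring ?_
      have h := hsplit (p.1 m) (Function.update p.1 m p.2)
      simp only [hB, Pi.zero_apply, smul_zero, Finset.sum_const_zero, add_zero,
        unitQuery_update] at h
      simpa using h
    funext j
    have h := hφ m ((s m).symm (Pi.single j 1))
    rw [hzero] at h
    simpa [Pi.single_apply] using h.symm

end Words

end

/-! ### Rates, field extension and conclusion -/

lemma IsInformationSet.card_eq {F : Type*} [Field F] {n k : ℕ} {G : Matrix (Fin k) (Fin n) F}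
    {I : Finset (Fin n)} (hI : IsInformationSet G I) : I.card = k := by
  obtain ⟨e, -⟩ := hI
  simpa using (Fintype.card_congr e).symm

/-- Double counting of the pairs `l ∈ I i` gives `ν k`, and `k` cancels. -/
lemma rate_mul_card {n k ν : ℕ} {I : Fin ν → Finset (Fin n)} (hI : ∀ i, (I i).card = k)
    (hk : 0 < k) (β c : ℕ) :
    rate n k β (fun l => c * (Finset.univ.filter fun i => l ∈ I i).card) =
      (β : ℝ) / (c * ν) := by
  have h : ∑ l, (Finset.univ.filter fun i => l ∈ I i).card = ν * k := by
    have := Finset.sum_card_bipartiteAbove_eq_sum_card_bipartiteBelow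
      (s := (Finset.univ : Finset (Fin n))) (t := (Finset.univ : Finset (Fin ν)))
      (fun l i => l ∈ I i)
    simp only [Finset.bipartiteAbove, Finset.bipartiteBelow] at this
    rw [this]
    simp [hI]
  have hk' : (k : ℝ) ≠ 0 := by exact_mod_cast hk.ne'
  rw [rate, ← Finset.mul_sum, h]
  push_cast
  rw [← mul_assoc, mul_div_mul_right _ _ hk']

lemma exists_finite_extension (F : Type*) [Field F] [Fintype F] (N : ℕ) :
    ∃ (E : Type) (_ : Field E) (_ : Fintype E) (_ : Algebra F E), N ≤ Fintype.card E := by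
  obtain ⟨p, hp⟩ := CharP.exists F
  have : Fact p.Prime := ⟨CharP.char_is_prime F p⟩
  refine ⟨FiniteField.Extension F p (N + 1), inferInstance, Fintype.ofFinite _, inferInstance, ?_⟩
  rw [Fintype.card_eq_nat_card, FiniteField.natCard_extension]
  calc N ≤ 2 ^ (N + 1) := (Nat.le_succ N).trans Nat.lt_two_pow_self.le
    _ ≤ Nat.card F ^ (N + 1) := Nat.pow_le_pow_left Finite.one_lt_card _

lemma tendsto_rateA {κ ν : ℕ} (hκν : κ < ν) :
    Filter.Tendsto (fun f => rateA κ ν f) Filter.atTop (𝓝 (1 - (κ : ℝ) / ν)) := by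
  have hν : (0 : ℝ) < ν := by exact_mod_cast (Nat.zero_le κ).trans_lt hκν
  have h : Filter.Tendsto (fun f : ℕ => ((κ : ℝ) / ν) ^ f) Filter.atTop (𝓝 0) :=
    tendsto_pow_atTop_nhds_zero_of_lt_one (by positivity)
      ((div_lt_one hν).2 (by exact_mod_cast hκν))
  simpa [rateA] using (((h.const_sub 1).inv₀ (by simp)).const_mul (1 - (κ : ℝ) / ν))

end PIR

theorem theorem4 {F : Type*} [Field F] [Fintype F] {n k : ℕ} (hk : 0 < k)
    (C : Submodule F (Fin n → F)) (G : Matrix (Fin k) (Fin n) F)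
    (hG : PIR.IsGeneratorMatrix C G)
    {κ ν : ℕ} (hκν : κ < ν) (Λ : Matrix (Fin ν) (Fin n) (ZMod 2))
    (hΛ : PIR.IsPIRAchievableRateMatrix G κ ν Λ) :
    ∃ I : Fin ν → Finset (Fin n),
      (∀ i, PIR.IsInformationSet G (I i) ∧ I i ⊆ PIR.rowSupport Λ i) ∧
      -- for every number of files, the rate is achievable
      (∀ f : ℕ, 1 ≤ f → ∃ (β : ℕ) (d : Fin n → ℕ), 1 ≤ β ∧ PIR.SchemeExists G f β d ∧
        PIR.HasProfile I d ∧ PIR.rate n k β d = PIR.rateA κ ν f) ∧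
      -- the limit rate, with file size and downloads that do not depend on the number of files
      (∃ (β : ℕ) (d : Fin n → ℕ), 1 ≤ β ∧ (∀ f : ℕ, 1 ≤ f → PIR.SchemeExists G f β d) ∧
        PIR.HasProfile I d ∧ PIR.rate n k β d = 1 - (κ : ℝ) / ν) ∧
      Filter.Tendsto (fun f => PIR.rateA κ ν f) Filter.atTop (𝓝 (1 - (κ : ℝ) / ν)) := by
  obtain ⟨hcol, hrow⟩ := hΛ
  choose I hI hIsub using hrow
  -- Dropping redundant coordinates only lowers the column weights.
  have hcard : ∀ l, (Finset.univ.filter fun i => l ∈ I i).card ≤ κ := fun l => by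
    rw [← hcol l, hammingNorm]
    refine Finset.card_le_card fun i hi => ?_
    simpa [PIR.rowSupport] using hIsub i (by simpa using hi)
  -- The array of the word scheme has one row per pair of server and letter.
  obtain ⟨E, _, _, _, hE⟩ := PIR.exists_finite_extension F (ν * ν)
  have hr : 0 < Module.finrank F E := Module.finrank_pos
  have hr' : (Module.finrank F E : ℝ) ≠ 0 := by exact_mod_cast hr.ne'
  have hν : 0 < ν := (Nat.zero_le κ).trans_lt hκν
  have hν' : (ν : ℝ) ≠ 0 := by exact_mod_cast hν.ne'
  have hsub : 0 < ν - κ := Nat.sub_pos_of_lt hκν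
  refine ⟨I, fun i => ⟨hI i, hIsub i⟩, fun f hf => ?_, ?_, PIR.tendsto_rateA hκν⟩
  · refine ⟨_, _, ?_, PIR.schemeExists_words hI hcard hκν.le hE f, ⟨_, fun l => rfl⟩, ?_⟩
    · exact Nat.mul_pos hr (Nat.mul_pos (pow_pos hν f) hsub)
    · have hlt : κ ^ f < ν ^ f := Nat.pow_lt_pow_left hκν (Nat.one_le_iff_ne_zero.1 hf)
      have hlt' : (ν : ℝ) ^ f - κ ^ f ≠ 0 := sub_ne_zero.2 (by exact_mod_cast hlt.ne')
      rw [PIR.rate_mul_card (fun i => (hI i).card_eq) hk, PIR.rateA]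
      push_cast [Nat.cast_sub hκν.le, Nat.cast_sub hlt.le]
      have h1 : 1 - ((κ : ℝ) / ν) ^ f = (ν ^ f - κ ^ f) / ν ^ f := by
        rw [div_pow]
        field_simp
      rw [h1]
      field_simp
  · refine ⟨_, _, ?_, fun f _ => PIR.schemeExists_files_independent hI hcard hκν.le
      ((Nat.le_mul_self ν).trans hE) f, ⟨_, fun l => rfl⟩, ?_⟩
    · exact Nat.mul_pos hr hsub
    · rw [PIR.rate_mul_card (fun i => (hI i).card_eq) hk]
      push_cast [Nat.cast_sub hκν.le]
      field_simp
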